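/- Let $G$ be a locally compact (Hausdorff) group with left Haar measure $\lambda$, let $M$ be a von Neumann algebra on a complex Hilbert space, with predual $M_*$ (the normal functionals on $M$), and let $x\mapsto\alpha_x$ be a homomorphism from $G$ into the group of $*$-automorphisms of $M$ such that $x\mapsto\alpha_x(m)$ is weak$^*$-continuous for each $m\in M$. Write $A=M_*$ and $\beta_x=(\alpha_{x^{-1}})_*$, so that $\beta_x:A\to A$ is given by $\langle m,\beta_x(a)\rangle=\langle\alpha_{x^{-1}}(m),a\rangle$. Assume that (a) the Banach space $A$ is equipped with a product making it a Banach algebra, and (b) each $\beta_x$ ($x\in G$) is an algebra automorphism of $A$. Definitions. A state on $M$ is a positive functional $p\in M^*$ with $p(1)=1$; let $S_*(M)\subset A$ be the set of normal states. $M$ is *$G$-amenable* if there is a state $p$ on $M$ with $p\circ\alpha_{x^{-1}}=p$ for all $x\in G$. A *left Banach $G$-$A$-module* is a complex Banach space $X$ with bounded linear operators $\xi\mapsto x\xi$ ($x\in G$) such that $\|x\xi\|\le\|\xi\|$, $x(y\xi)=(xy)\xi$ and $x\mapsto x\xi$ is norm continuous for each $\xi$, and with a left $A$-module structure (bilinear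 over $\mathbb C$, $(ab)\xi=a(b\xi)$) such that $\|a\xi\|\le\|a\|\|\xi\|$ and $\beta_x(a)\xi=x(a(x^{-1}\xi))$ for all $x\in G$, $a\in A$, $\xi\in X$. For such $X$ let $T_x,T_a\in B(X^{**})$ be the second transposes of $\xi\mapsto x\xi$ and $\xi\mapsto a\xi$. Let $P_X$ be the closure of $\{T_a: a\in S_*(M)\}$ in the weak$^*$-topology of $B(X^{**})=(X^{**}\hat\otimes X^*)^*$, where $\langle T,m\otimes w\rangle=(Tm)(w)$. $X$ has a *$G$-$A$-fixed point* if there is $T_0\in P_X$ with $T_xT_0T_{x^{-1}}=T_0$ for all $x\in G$. $A$ has the *$G$-fixed point property* if every left Banach $G$-$A$-module has a $G$-$A$-fixed point. Let $A^1=A\oplus\mathbb C1$ be the unitization of $A$ with $\|a+c1\|=\|a\|+|c|$; $A$ acts on it by left multiplication and $G$ by $x(a+c1)=\beta_x(a)+c1$; denote the latter operator again by $\beta_x$. Let $L^1(G,A^1)$ be the space of Bochner integrable $A^1$-valued functions with respect to $\lambda$ (the completion of $C_c(G,A^1)$ in the $L^1$-norm), with $(af)(t)=a(f(t))$ and $(xf)(t)=\beta_x(f(x^{-1}t))$.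 Theorem. The following statements are equivalent: (i) $M$ is $G$-amenable; (ii) $A$ has the $G$-fixed point property; (iii) $A^1$ has a $G$-$A$-fixed point; (iv) $L^1(G,A^1)$ has a $G$-$A$-fixed point. -/

import Mathlib

open MeasureTheory
open scoped InnerProductSpace ComplexOrder Topology

universe u v w

noncomputable section

namespace GAmenable

/-! ### States and the predual of a von Neumann algebra -/

section VonNeumann

variable {H : Type u} [NormedAddCommGroup H] [InnerProductSpace ℂ H] [CompleteSpace H]

/-- The elements of a von Neumann algebra `M` on `H`, as a type (with the operator norm). -/
abbrev Elt (M : VonNeumannAlgebra H) : Type u := M.toStarSubalgebra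

/-- A state: a positive bounded linear functional taking the value `1` at the identity
(for positive functionals this is the same as having norm `1`). -/
def IsState {M : VonNeumannAlgebra H} (p : StrongDual ℂ (Elt M)) : Prop :=
  (∀ m : Elt M, 0 ≤ p (star m * m)) ∧ p 1 = 1

/-- `φ` is normal (ultraweakly continuous): `φ(m) = ∑ ⟨m ξₙ, ηₙ⟩` for square-summable sequences
`ξ`, `η` in `H`. (Mathlib's inner product is linear in the second variable.) -/
def IsNormal {M : VonNeumannAlgebra H} (φ : StrongDual ℂ (Elt M)) : Prop :=
  ∃ ξ η : ℕ → H, Summable (fun n => ‖ξ n‖ ^ 2) ∧ Summable (fun n => ‖η n‖ ^ 2) ∧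
    ∀ m : Elt M, HasSum (fun n => ⟪η n, (m : H →L[ℂ] H) (ξ n)⟫_ℂ) (φ m)

theorem IsNormal.add {M : VonNeumannAlgebra H} {φ ψ : StrongDual ℂ (Elt M)}
    (hφ : IsNormal φ) (hψ : IsNormal ψ) : IsNormal (φ + ψ) := by
  obtain ⟨ξ, η, h1, h2, h3⟩ := hφ
  obtain ⟨ξ', η', h1', h2', h3'⟩ := hψ
  let e := Equiv.natSumNatEquivNat
  refine ⟨Sum.elim ξ ξ' ∘ e.symm, Sum.elim η η' ∘ e.symm, ?_, ?_, fun m => ?_⟩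
  · exact (e.symm.summable_iff (f := fun s => ‖Sum.elim ξ ξ' s‖ ^ 2)).2 (Summable.sum _ h1 h1')
  · exact (e.symm.summable_iff (f := fun s => ‖Sum.elim η η' s‖ ^ 2)).2 (Summable.sum _ h2 h2')
  · exact (e.symm.hasSum_iff
      (f := fun s => ⟪Sum.elim η η' s, (m : H →L[ℂ] H) (Sum.elim ξ ξ' s)⟫_ℂ)).2
      (HasSum.sum (h3 m) (h3' m))

/-- The predual `M_*`: the space of normal functionals, with the norm of the dual of `M`. -/
def predual (M : VonNeumannAlgebra H) : Submodule ℂ (StrongDual ℂ (Elt M)) where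
  carrier := {φ | IsNormal φ}
  add_mem' := IsNormal.add
  zero_mem' := ⟨0, 0, by simp, by simp, by simp⟩
  smul_mem' := by
    rintro c φ ⟨ξ, η, h1, h2, h3⟩
    refine ⟨c • ξ, η, ?_, h2, fun m => ?_⟩
    · simpa [norm_smul, mul_pow] using h1.mul_left (‖c‖ ^ 2)
    · simpa [inner_smul_right] using (h3 m).mul_left c

end VonNeumann

/-! ### Modules -/

section Modules

variable {G : Type v} [Group G] [TopologicalSpace G]
variable {A : Type w} [NonUnitalNormedRing A] [NormedSpace ℂ A]

/-- A left Banach `G`-`A`-module structure on a Banach space `X`, where `G` acts on the Banach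
algebra `A` by `β`: contractive, strongly continuous operators `ξ ↦ xξ`, a left `A`-module structure
with `‖aξ‖ ≤ ‖a‖ ‖ξ‖`, and the covariance relation `β_x(a)ξ = x(a(x⁻¹ξ))`. -/
structure BanachGAModule (β : G → A →L[ℂ] A) (X : Type*) [NormedAddCommGroup X]
    [NormedSpace ℂ X] where
  /-- the action of `G` -/
  gact : G → X →L[ℂ] X
  norm_gact_le : ∀ x ξ, ‖gact x ξ‖ ≤ ‖ξ‖
  gact_mul : ∀ x y ξ, gact (x * y) ξ = gact x (gact y ξ)
  continuous_gact : ∀ ξ, Continuous fun x => gact x ξ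
  /-- the action of `A` -/
  aact : A →L[ℂ] X →L[ℂ] X
  norm_aact_le : ∀ a ξ, ‖aact a ξ‖ ≤ ‖a‖ * ‖ξ‖
  aact_mul : ∀ a b ξ, aact (a * b) ξ = aact a (aact b ξ)
  covariant : ∀ x a ξ, aact (β x a) ξ = gact x (aact a (gact x⁻¹ ξ))

end Modules

/-! ### Operators on the bidual -/

section Bidual

/-- The bidual of a normed space. -/
abbrev Bidual (X : Type*) [NormedAddCommGroup X] [NormedSpace ℂ X] : Type _ :=
  StrongDual ℂ (StrongDual ℂ X)

variable {X : Type*} [NormedAddCommGroup X] [NormedSpace ℂ X]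

/-- The Banach space transpose `f ↦ f ∘ S`. -/
def transpose (S : X →L[ℂ] X) : StrongDual ℂ X →L[ℂ] StrongDual ℂ X :=
  (ContinuousLinearMap.compL ℂ X X ℂ).flip S

/-- The second transpose `S**` on the bidual: `(S** n)(f) = n(f ∘ S)`. -/
def bitranspose (S : X →L[ℂ] X) : Bidual X →L[ℂ] Bidual X :=
  transpose (transpose S)

@[simp]
theorem bitranspose_apply (S : X →L[ℂ] X) (n : Bidual X) (f : StrongDual ℂ X) :
    bitranspose S n f = n (f.comp S) := rfl

variable (X) in
/-- Pairs of sequences `(mₙ)` in `X**`, `(wₙ)` in `X*` with `∑ ‖mₙ‖ ‖wₙ‖ < ∞`; the series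
`∑ mₙ ⊗ wₙ` are exactly the elements of the projective tensor product of `X**` and `X*`. -/
def ProjSeries : Type _ :=
  {p : (ℕ → Bidual X) × (ℕ → StrongDual ℂ X) // Summable fun n => ‖p.1 n‖ * ‖p.2 n‖}

variable (X) in
/-- The weak* topology of `B(X**)`, seen as the dual of the projective tensor product of `X**`
and `X*` through `⟨T, m ⊗ w⟩ = (T m)(w)`. -/
abbrev weakStarTopology : TopologicalSpace (Bidual X →L[ℂ] Bidual X) :=
  TopologicalSpace.induced
    (fun T (p : ProjSeries X) => ∑' n, T (p.1.1 n) (p.1.2 n)) Pi.topologicalSpace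

end Bidual

/-! ### Fixed points -/

section FixedPoints

variable {H : Type u} [NormedAddCommGroup H] [InnerProductSpace ℂ H] [CompleteSpace H]
variable {M : VonNeumannAlgebra H}
variable {G : Type v} [Group G] [TopologicalSpace G]
variable {A : Type w} [NonUnitalNormedRing A] [NormedSpace ℂ A]

/-- `M` is `G`-amenable for the action `α`: it has a `G`-invariant state. -/
def IsGAmenable (α : G →* (Elt M ≃⋆ₐ[ℂ] Elt M)) : Prop :=
  ∃ p : StrongDual ℂ (Elt M), IsState p ∧ ∀ (x : G) (m : Elt M), p (α x⁻¹ m) = p m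

/-- The set `P_X`: the weak*-closure in `B(X**)` of the operators `T_a`, `a` a normal state, where
`aact a` is the operator `ξ ↦ aξ` on `X` and `T_a` is its second transpose. Here `A` is identified
with `M_*` by `ι`. -/
def PSet (ι : A ≃ₗᵢ[ℂ] predual M) {X : Type*} [NormedAddCommGroup X] [NormedSpace ℂ X]
    (aact : A → X →L[ℂ] X) : Set (Bidual X →L[ℂ] Bidual X) :=
  closure[weakStarTopology X]
    {T | ∃ a : A, IsState (ι a : StrongDual ℂ (Elt M)) ∧ T = bitranspose (aact a)}

/-- A space `X` with operators `gact x` (`x ∈ G`) and `aact a` (`a ∈ A`) has a `G`-`A`-fixed point: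
some `T₀ ∈ P_X` satisfies `T_x T₀ T_{x⁻¹} = T₀` for all `x ∈ G`. -/
def HasGAFixedPoint (ι : A ≃ₗᵢ[ℂ] predual M) {X : Type*} [NormedAddCommGroup X]
    [NormedSpace ℂ X] (gact : G → X →L[ℂ] X) (aact : A → X →L[ℂ] X) : Prop :=
  ∃ T₀ ∈ PSet ι aact, ∀ x : G,
    (bitranspose (gact x)).comp (T₀.comp (bitranspose (gact x⁻¹))) = T₀

/-- The `G`-fixed point property of `A`: every left Banach `G`-`A`-module has a fixed point. -/
def HasGFixedPointProperty (ι : A ≃ₗᵢ[ℂ] predual M) (β : G → A →L[ℂ] A) : Prop :=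
  ∀ (X : Type (max v w)) [NormedAddCommGroup X] [NormedSpace ℂ X] [CompleteSpace X]
    (Y : BanachGAModule β X), HasGAFixedPoint ι Y.gact fun a => Y.aact a

end FixedPoints

/-! ### The modules `A¹` and `L¹(G, A¹)` -/

section Examples

variable {A : Type w} [NonUnitalNormedRing A] [NormedSpace ℂ A]

variable (A) in
/-- The unitization `A¹ = A ⊕ ℂ1`, with the norm `‖a + c1‖ = ‖a‖ + |c|`. -/
abbrev Unit1 : Type w := WithLp 1 (Unitization ℂ A)

variable [IsScalarTower ℂ A A] [SMulCommClass ℂ A A]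

/-- The extension of a bounded operator `b` on `A` to `A¹` by `a + c1 ↦ b(a) + c1`. -/
def unit1Map (b : A →L[ℂ] A) : Unit1 A →L[ℂ] Unit1 A :=
  LinearMap.mkContinuous
    { toFun := fun z => WithLp.toLp 1
        (Unitization.inl (WithLp.ofLp z).fst + Unitization.inr (b (WithLp.ofLp z).snd))
      map_add' := fun y z => by
        apply (WithLp.equiv 1 (Unitization ℂ A)).injective
        ext <;> simp
      map_smul' := fun c z => by
        apply (WithLp.equiv 1 (Unitization ℂ A)).injective
        ext <;> simp }
    (max 1 ‖b‖) (fun z => by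
      simp only [LinearMap.coe_mk, AddHom.coe_mk, WithLp.unitization_norm_def]
      simp only [Unitization.fst_add, Unitization.fst_inl, Unitization.fst_inr, add_zero,
        Unitization.snd_add, Unitization.snd_inl, Unitization.snd_inr, zero_add, mul_add]
      gcongr
      · exact le_mul_of_one_le_left (norm_nonneg _) (le_max_left _ _)
      · exact (b.le_opNorm _).trans (by gcongr; exact le_max_right _ _))

/-- Left multiplication by `a ∈ A` on `A¹`. -/
def unit1Mul (a : A) : Unit1 A →L[ℂ] Unit1 A :=
  ContinuousLinearMap.mul ℂ (Unit1 A) (WithLp.toLp 1 (a : Unitization ℂ A))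

variable {G : Type v} [Group G] [TopologicalSpace G] [IsTopologicalGroup G]
  [MeasurableSpace G] [BorelSpace G] (μ : Measure G) [μ.IsMulLeftInvariant]

/-- The operator `f ↦ xf` on `L¹(G, A¹)`, `(xf)(t) = β_x(f(x⁻¹t))`. -/
def l1GAct (β : G → A →L[ℂ] A) (x : G) : Lp (Unit1 A) 1 μ →L[ℂ] Lp (Unit1 A) 1 μ :=
  ((unit1Map (β x)).compLpL 1 μ).comp
    (Lp.compMeasurePreservingₗᵢ ℂ (fun t : G => x⁻¹ * t)
      (measurePreserving_mul_left μ x⁻¹)).toContinuousLinearMap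

/-- The operator `f ↦ af` on `L¹(G, A¹)`, `(af)(t) = a(f(t))`. -/
def l1AAct (a : A) : Lp (Unit1 A) 1 μ →L[ℂ] Lp (Unit1 A) 1 μ :=
  (unit1Mul a).compLpL 1 μ

end Examples

end GAmenable

end

noncomputable section

namespace GAmenable

/-! ### A von Neumann algebra as the dual of its predual; density of normal states. -/

section VonNeumannAlgebra

open Filter

variable {H : Type u} [NormedAddCommGroup H] [InnerProductSpace ℂ H] [CompleteSpace H]
variable {M : VonNeumannAlgebra H}

/-! All implications pass through `G`-amenability. Since `M` is the dual of `A`, the map `a ↦ T_a`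
extends from `A` to its bidual (`arensOperator`): a pair `(n, f)` in `X** × X*` gives the functional
`a ↦ n(f ∘ a)` on `A`, that is, an element of `M`, at which a functional on `M` can be evaluated.
Normal states are weak*-dense in the states (`exists_filter_normalStates`), so a state gives an
element of `P_X`; covariance turns its invariance into the fixed point equation
(`hasGAFixedPoint_of_isGAmenable`).

Conversely, the vector `1` of `A¹` is fixed by `G` and `a1 = a`. For a fixed point `T`, the
coefficient of `T` at `1`, taken against `m ∈ M` extended by `m(1) = 0`, is a limit of normal
states, hence a state, and it is invariant (`isGAmenable_of_hasGAFixedPoint`). In `L¹(G, A¹)` a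
vector of integral `1` replaces `1`, since the Bochner integral intertwines all actions. To apply
the fixed point property to `A¹`, its `G`-action must be norm continuous: weak*-continuity of `α`
only gives weak continuity of `β`, and `continuous_of_weakly_continuous` upgrades it. -/

theorem mem_of_commute_commutant {T : H →L[ℂ] H}
    (hT : ∀ u : H →L[ℂ] H, (∀ m ∈ M, m * u = u * m) → u * T = T * u) : T ∈ M := by
  rw [← SetLike.mem_coe, ← VonNeumannAlgebra.centralizer_centralizer]
  exact fun u hu => hT u hu

variable (M) in
/-- The functional `m ↦ ⟪η, m ξ⟫`, as a function of `ξ`. -/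
def vectorFunctional (η ξ : H) : StrongDual ℂ (Elt M) :=
  LinearMap.mkContinuous
    { toFun := fun m => ⟪η, (m : H →L[ℂ] H) ξ⟫_ℂ
      map_add' := fun m n => by simp
      map_smul' := fun c m => by simp }
    (‖η‖ * ‖ξ‖) (fun m => by
      simp only [LinearMap.coe_mk, AddHom.coe_mk]
      refine (norm_inner_le_norm _ _).trans ?_
      have := (m : H →L[ℂ] H).le_opNorm ξ
      calc ‖η‖ * ‖(m : H →L[ℂ] H) ξ‖ ≤ ‖η‖ * (‖(m : H →L[ℂ] H)‖ * ‖ξ‖) := by gcongr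
        _ = ‖η‖ * ‖ξ‖ * ‖m‖ := by rw [mul_comm ‖(m : H →L[ℂ] H)‖, mul_assoc]; rfl)

@[simp]
theorem vectorFunctional_apply (η ξ : H) (m : Elt M) :
    vectorFunctional M η ξ m = ⟪η, (m : H →L[ℂ] H) ξ⟫_ℂ := rfl

theorem norm_vectorFunctional_le (η ξ : H) : ‖vectorFunctional M η ξ‖ ≤ ‖η‖ * ‖ξ‖ :=
  LinearMap.mkContinuous_norm_le _ (by positivity) _

theorem isNormal_vectorFunctional (η ξ : H) : IsNormal (vectorFunctional M η ξ) := by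
  refine ⟨Pi.single 0 ξ, Pi.single 0 η, ?_, ?_, fun m => ?_⟩
  · exact summable_of_ne_finset_zero (s := {0}) fun n hn => by
      simp [Pi.single_eq_of_ne (by simpa using hn : n ≠ 0)]
  · exact summable_of_ne_finset_zero (s := {0}) fun n hn => by
      simp [Pi.single_eq_of_ne (by simpa using hn : n ≠ 0)]
  · convert hasSum_single (f := fun n => ⟪(Pi.single 0 η : ℕ → H) n,
      (m : H →L[ℂ] H) ((Pi.single 0 ξ : ℕ → H) n)⟫_ℂ) 0 fun n hn => by simp [hn] using 1
    simp

variable (M) in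
/-- The functional `m ↦ ⟪η, m ξ⟫` as an element of the predual. -/
def vectorPredual (η ξ : H) : predual M :=
  ⟨vectorFunctional M η ξ, isNormal_vectorFunctional η ξ⟩

@[simp]
theorem coe_vectorPredual_apply (η ξ : H) (m : Elt M) :
    (vectorPredual M η ξ : StrongDual ℂ (Elt M)) m = ⟪η, (m : H →L[ℂ] H) ξ⟫_ℂ := rfl

/-- The predual separates the points of a von Neumann algebra. -/
theorem elt_ext_predual {m n : Elt M}
    (h : ∀ φ : predual M, (φ : StrongDual ℂ (Elt M)) m = (φ : StrongDual ℂ (Elt M)) n) :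
    m = n := by
  apply Subtype.ext
  ext ξ
  refine ext_inner_left ℂ fun η => ?_
  simpa using h (vectorPredual M η ξ)

variable {A : Type w} [NormedAddCommGroup A] [NormedSpace ℂ A] (ι : A ≃ₗᵢ[ℂ] predual M)

theorem elt_ext {m n : Elt M}
    (h : ∀ a, (ι a : StrongDual ℂ (Elt M)) m = (ι a : StrongDual ℂ (Elt M)) n) : m = n :=
  elt_ext_predual fun φ => by
    obtain ⟨a, rfl⟩ := ι.surjective φ
    exact h a

theorem predual_ext {a b : A}
    (h : ∀ m, (ι a : StrongDual ℂ (Elt M)) m = (ι b : StrongDual ℂ (Elt M)) m) : a = b :=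
  ι.injective (Subtype.ext (ContinuousLinearMap.ext h))

/-- The element of `A` given by the functional `m ↦ ⟪η, m ξ⟫`. -/
def vectorElt (η ξ : H) : A := ι.symm (vectorPredual M η ξ)

@[simp]
theorem vectorElt_apply (η ξ : H) (m : Elt M) :
    (ι (vectorElt ι η ξ) : StrongDual ℂ (Elt M)) m = ⟪η, (m : H →L[ℂ] H) ξ⟫_ℂ := by
  simp [vectorElt]

theorem norm_vectorElt_le (η ξ : H) : ‖vectorElt ι η ξ‖ ≤ ‖η‖ * ‖ξ‖ := by
  rw [vectorElt, LinearIsometryEquiv.norm_map]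
  exact norm_vectorFunctional_le η ξ

/-- A bounded functional on the predual gives a bounded sesquilinear form on `H`. -/
def sesqForm (Φ : StrongDual ℂ A) : H →L⋆[ℂ] H →L[ℂ] ℂ :=
  LinearMap.mkContinuous₂
    (LinearMap.mk₂'ₛₗ (starRingEnd ℂ) (RingHom.id ℂ) (fun η ξ => Φ (vectorElt ι η ξ))
      (fun η η' ξ => by
        rw [← map_add]; congr 1; apply predual_ext ι; intro m; simp)
      (fun c η ξ => by
        rw [← map_smul]; congr 1; apply predual_ext ι; intro m
        simp [mul_comm])
      (fun η ξ ξ' => by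
        rw [← map_add]; congr 1; apply predual_ext ι; intro m; simp)
      (fun c η ξ => by
        rw [← map_smul]; congr 1; apply predual_ext ι; intro m
        simp))
    ‖Φ‖ (fun η ξ => by
      refine (Φ.le_opNorm _).trans ?_
      rw [mul_assoc]
      gcongr
      exact norm_vectorElt_le ι η ξ)

theorem sesqForm_apply (Φ : StrongDual ℂ A) (η ξ : H) :
    sesqForm ι Φ η ξ = Φ (vectorElt ι η ξ) := rfl

/-- Riesz representation of the bounded form `sesqForm`. The adjoint appears because
`continuousLinearMapOfBilin` puts the operator in the left slot of the inner product. -/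
theorem exists_operator (Φ : StrongDual ℂ A) :
    ∃ T : H →L[ℂ] H, ‖T‖ ≤ ‖Φ‖ ∧ ∀ η ξ, ⟪η, T ξ⟫_ℂ = Φ (vectorElt ι η ξ) := by
  have key : ∀ η ξ, ⟪η, (InnerProductSpace.continuousLinearMapOfBilin (sesqForm ι Φ)).adjoint ξ⟫_ℂ
      = Φ (vectorElt ι η ξ) := fun η ξ => by
    rw [ContinuousLinearMap.adjoint_inner_right,
      InnerProductSpace.continuousLinearMapOfBilin_apply, sesqForm_apply]
  refine ⟨_, ?_, key⟩
  refine ContinuousLinearMap.opNorm_le_bound _ (norm_nonneg _) fun ξ => ?_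
  set T := (InnerProductSpace.continuousLinearMapOfBilin (sesqForm ι Φ)).adjoint
  by_cases h0 : ‖T ξ‖ = 0
  · rw [h0]; positivity
  have h1 : ‖T ξ‖ * ‖T ξ‖ ≤ ‖T ξ‖ * (‖Φ‖ * ‖ξ‖) := by
    rw [← inner_self_eq_norm_mul_norm (𝕜 := ℂ)]
    refine (RCLike.re_le_norm _).trans ?_
    rw [key]
    refine (Φ.le_opNorm _).trans ?_
    have : ‖vectorElt ι (T ξ) ξ‖ ≤ ‖T ξ‖ * ‖ξ‖ := norm_vectorElt_le ι _ _
    calc ‖Φ‖ * ‖vectorElt ι (T ξ) ξ‖ ≤ ‖Φ‖ * (‖T ξ‖ * ‖ξ‖) := by gcongr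
      _ = _ := by ring
  exact le_of_mul_le_mul_left h1 (lt_of_le_of_ne (norm_nonneg _) (Ne.symm h0))

/-- A normal functional is the norm convergent sum of vector functionals. -/
theorem hasSum_vectorElt (a : A) {ξ η : ℕ → H} (hξ : Summable fun n => ‖ξ n‖ ^ 2)
    (hη : Summable fun n => ‖η n‖ ^ 2)
    (h : ∀ m : Elt M, HasSum (fun n => ⟪η n, (m : H →L[ℂ] H) (ξ n)⟫_ℂ)
      ((ι a : StrongDual ℂ (Elt M)) m)) :
    HasSum (fun n => vectorElt ι (η n) (ξ n)) a := by
  have hs : Summable fun n => vectorFunctional M (η n) (ξ n) := by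
    -- Absolute convergence takes place in the full dual of `M`, by `‖η‖ ‖ξ‖ ≤ ‖η‖² + ‖ξ‖²`; the
    -- limit is already known to be normal.
    refine Summable.of_norm_bounded (g := fun n => ‖η n‖ ^ 2 + ‖ξ n‖ ^ 2) (hη.add hξ) fun n => ?_
    refine (norm_vectorFunctional_le _ _).trans ?_
    nlinarith [sq_nonneg (‖η n‖ - ‖ξ n‖), sq_nonneg (‖η n‖), sq_nonneg (‖ξ n‖)]
  have h2 : HasSum (fun n => vectorFunctional M (η n) (ξ n)) (ι a : StrongDual ℂ (Elt M)) := by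
    convert hs.hasSum using 1
    ext m
    exact (h m).unique
      (hs.hasSum.mapL (ContinuousLinearMap.apply ℂ ℂ m))
  have h3 : HasSum (fun n => vectorPredual M (η n) (ξ n)) (ι a) :=
    (Topology.IsInducing.subtypeVal.hasSum_iff (g := (predual M).subtype)
      (fun n => vectorPredual M (η n) (ξ n)) (ι a)).1 h2
  have h4 := h3.map ι.symm.toLinearEquiv.toAddMonoidHom ι.symm.continuous
  exact (ι.symm_apply_apply a) ▸ h4

/-- A von Neumann algebra is the dual of its predual. -/
theorem exists_elt (Φ : StrongDual ℂ A) :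
    ∃ m : Elt M, ‖m‖ ≤ ‖Φ‖ ∧ ∀ a : A, (ι a : StrongDual ℂ (Elt M)) m = Φ a := by
  obtain ⟨T, hT, h⟩ := exists_operator ι Φ
  -- For `u` in the commutant, `m ↦ ⟪η, m u ξ⟫` and `m ↦ ⟪u* η, m ξ⟫` are the same functional on
  -- `M`, so `Φ` cannot distinguish them; the bicommutant theorem concludes.
  have hM : T ∈ M := by
    refine mem_of_commute_commutant fun u hu => ?_
    ext ξ
    refine ext_inner_left ℂ fun η => ?_
    rw [mul_apply_eq_comp, mul_apply_eq_comp, h,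
      ← ContinuousLinearMap.adjoint_inner_left, h]
    congr 1
    apply predual_ext ι
    intro m
    rw [vectorElt_apply, vectorElt_apply, ContinuousLinearMap.adjoint_inner_left,
      ← mul_apply_eq_comp, ← mul_apply_eq_comp, hu _ m.2]
  refine ⟨⟨T, hM⟩, hT, fun a => ?_⟩
  obtain ⟨ξ, η, h1, h2, h3⟩ := (ι a).2
  refine (h3 ⟨T, hM⟩).unique ?_
  simpa [h] using (hasSum_vectorElt ι a h1 h2 h3).mapL Φ

/-- The element of `M` representing a functional on the predual. -/
def eltOfDual (Φ : StrongDual ℂ A) : Elt M := (exists_elt ι Φ).choose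

theorem norm_eltOfDual_le (Φ : StrongDual ℂ A) : ‖eltOfDual ι Φ‖ ≤ ‖Φ‖ :=
  (exists_elt ι Φ).choose_spec.1

@[simp]
theorem apply_eltOfDual (Φ : StrongDual ℂ A) (a : A) :
    (ι a : StrongDual ℂ (Elt M)) (eltOfDual ι Φ) = Φ a :=
  (exists_elt ι Φ).choose_spec.2 a

/-- If `A` is the predual of `M`, the canonical map from `A*` to `M`. -/
def ofDual : StrongDual ℂ A →L[ℂ] Elt M :=
  LinearMap.mkContinuous
    { toFun := eltOfDual ι
      map_add' := fun Φ Ψ => elt_ext ι fun a => by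
        rw [map_add]; simp only [apply_eltOfDual]; rfl
      map_smul' := fun c Φ => elt_ext ι fun a => by
        rw [map_smul]; simp only [apply_eltOfDual]; rfl }
    1 (fun Φ => by simpa using norm_eltOfDual_le ι Φ)

@[simp]
theorem apply_ofDual (Φ : StrongDual ℂ A) (a : A) :
    (ι a : StrongDual ℂ (Elt M)) (ofDual ι Φ) = Φ a :=
  apply_eltOfDual ι Φ a

/-- A `*`-isomorphism of C*-algebras is isometric; `M` is norm closed because it is a centralizer.
-/
theorem norm_starAlgEquiv_apply (e : Elt M ≃⋆ₐ[ℂ] Elt M) (m : Elt M) : ‖e m‖ = ‖m‖ := by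
  have hc : IsClosed (M.toStarSubalgebra : Set (H →L[ℂ] H)) := by
    rw [VonNeumannAlgebra.coe_toStarSubalgebra, ← VonNeumannAlgebra.centralizer_centralizer]
    exact Set.isClosed_centralizer _
  let _ : CStarAlgebra (Elt M) := StarSubalgebra.cstarAlgebra M.toStarSubalgebra (h_closed := hc)
  exact StarAlgEquiv.norm_map e m

/-! ### States -/

/-- The positive square root commutes with whatever commutes with `h`, so it stays in `M`. This lets
a state be applied to an element known to be positive only as a quadratic form. -/
theorem exists_star_mul_self {h : Elt M}
    (hh : ∀ ξ, 0 ≤ ⟪ξ, (h : H →L[ℂ] H) ξ⟫_ℂ) : ∃ k : Elt M, h = star k * k := by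
  have hpos : 0 ≤ (h : H →L[ℂ] H) := by
    rw [ContinuousLinearMap.nonneg_iff_isPositive, ContinuousLinearMap.isPositive_iff_complex]
    intro ξ
    have h1 := Complex.nonneg_iff.1 (hh ξ)
    have h2 : ⟪(h : H →L[ℂ] H) ξ, ξ⟫_ℂ = ⟪ξ, (h : H →L[ℂ] H) ξ⟫_ℂ := by
      rw [← inner_conj_symm]
      exact Complex.conj_eq_iff_im.2 h1.2.symm
    rw [h2]
    exact ⟨Complex.ext (by simp) (by simpa using h1.2), h1.1⟩
  have hmem : CFC.sqrt (h : H →L[ℂ] H) ∈ M := mem_of_commute_commutant fun u hu => by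
    have hc : Commute (h : H →L[ℂ] H) u := hu _ h.2
    have := hc.cfc_nnreal NNReal.sqrt
    rw [← CFC.sqrt_eq_cfc] at this
    exact this.symm
  refine ⟨⟨_, hmem⟩, Subtype.ext ?_⟩
  have hs : IsSelfAdjoint (CFC.sqrt (h : H →L[ℂ] H)) := (CFC.sqrt_nonneg _).isSelfAdjoint
  change (h : H →L[ℂ] H) = star (CFC.sqrt (h : H →L[ℂ] H)) * CFC.sqrt (h : H →L[ℂ] H)
  rw [hs.star_eq, CFC.sqrt_mul_sqrt_self _ hpos]

theorem isState_vectorFunctional {ξ : H} (hξ : ‖ξ‖ = 1) : IsState (vectorFunctional M ξ ξ) := by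
  refine ⟨fun m => ?_, ?_⟩
  · have : ⟪ξ, ((star m * m : Elt M) : H →L[ℂ] H) ξ⟫_ℂ =
        ⟪(m : H →L[ℂ] H) ξ, (m : H →L[ℂ] H) ξ⟫_ℂ := by
      rw [← ContinuousLinearMap.adjoint_inner_right]; rfl
    rw [vectorFunctional_apply, this, inner_self_eq_norm_sq_to_K]
    refine (Complex.zero_le_real.2 (sq_nonneg ‖(m : H →L[ℂ] H) ξ‖)).trans_eq ?_
    push_cast
    rfl
  · simp [inner_self_eq_norm_sq_to_K, hξ]

/-- Both `p(h²)` and `p((1 + h)²) = 1 + 2p(h) + p(h²)` are real. -/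
theorem IsState.im_eq_zero {p : StrongDual ℂ (Elt M)} (hp : IsState p) {h : Elt M}
    (hh : star h = h) : (p h).im = 0 := by
  have h1 := (Complex.nonneg_iff.1 (hp.1 (1 + h))).2
  have h2 := (Complex.nonneg_iff.1 (hp.1 h)).2
  rw [hh] at h2
  simp only [star_add, star_one, hh, add_mul, mul_add, one_mul, mul_one, map_add, hp.2,
    Complex.add_im, Complex.one_im, ← h2] at h1
  linarith

theorem IsState.re_star {p : StrongDual ℂ (Elt M)} (hp : IsState p) (m : Elt M) :
    (p (star m)).re = (p m).re := by
  have := hp.im_eq_zero (h := Complex.I • (m - star m)) (by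
    rw [star_smul, star_sub, star_star]
    simp only [RCLike.star_def, Complex.conj_I, neg_smul, ← smul_neg, neg_sub])
  simp only [map_smul, map_sub, smul_eq_mul, Complex.mul_im, Complex.I_re, Complex.I_im,
    Complex.sub_re] at this
  linarith

/-- Hahn-Banach in a weak topology: a point which cannot be strictly separated from a convex set is
a limit of elements of this set. -/
theorem exists_filter_tendsto_of_re_le {X E F : Type*} [AddCommGroup E] [Module ℂ E]
    [AddCommGroup F] [Module ℂ F] (B : E →ₗ[ℂ] F →ₗ[ℂ] ℂ) (j : X → E) {S : Set X}
    (hS : ∀ a ∈ S, ∀ b ∈ S, ∀ s t : ℝ, 0 ≤ s → 0 ≤ t → s + t = 1 →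
      ∃ c ∈ S, j c = (s : ℂ) • j a + (t : ℂ) • j b) {p : E}
    (hp : ∀ y s, (∀ a ∈ S, (B (j a) y).re < s) → (B p y).re ≤ s) :
    ∃ l : Filter X, l.NeBot ∧ (∀ᶠ a in l, a ∈ S) ∧
      ∀ y, Tendsto (fun a => B (j a) y) l (𝓝 (B p y)) := by
  let k : X → WeakBilin B := j
  let q : WeakBilin B := p
  have : ContinuousSMul ℝ (WeakBilin B) := IsScalarTower.continuousSMul ℂ
  have hconv : Convex ℝ (k '' S) := by
    rintro _ ⟨a, ha, rfl⟩ _ ⟨b, hb, rfl⟩ s t hs ht hst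
    obtain ⟨c, hc, h⟩ := hS a ha b hb s t hs ht hst
    exact ⟨c, hc, h⟩
  have hq : q ∈ closure (k '' S) := by
    by_contra hcon
    obtain ⟨f, s, hf, hfq⟩ := RCLike.geometric_hahn_banach_closed_point (𝕜 := ℂ)
      hconv.closure isClosed_closure hcon
    -- Every functional continuous for the weak topology is a pairing with some `y`.
    obtain ⟨y, rfl⟩ := B.dualEmbedding_surjective f
    exact absurd (hp y s fun a ha => hf _ (subset_closure ⟨a, ha, rfl⟩)) (not_le.2 hfq)
  refine ⟨comap k (𝓝 q) ⊓ 𝓟 S, ?_, ?_, fun y => ?_⟩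
  · rw [mem_closure_iff_clusterPt, ClusterPt, ← map_principal] at hq
    rw [← map_neBot_iff k, inf_comm, Filter.push_pull, inf_comm]
    exact hq
  · exact mem_inf_of_right (mem_principal_self S)
  · exact ((WeakBilin.eval_continuous B y).tendsto q).comp
      (tendsto_comap.mono_left inf_le_left)

/-- Normal states are weak*-dense in the states. -/
theorem exists_filter_normalStates {p : StrongDual ℂ (Elt M)} (hp : IsState p) :
    ∃ F : Filter A, F.NeBot ∧ (∀ᶠ a in F, IsState (ι a : StrongDual ℂ (Elt M))) ∧
      ∀ m, Tendsto (fun a => (ι a : StrongDual ℂ (Elt M)) m) F (𝓝 (p m)) := by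
  refine exists_filter_tendsto_of_re_le (topDualPairing ℂ (Elt M))
    (fun a => (ι a : StrongDual ℂ (Elt M))) (S := {a | IsState (ι a : StrongDual ℂ (Elt M))})
    (p := p) ?_ ?_
  · intro a ha b hb s t hs ht hst
    refine ⟨(s : ℂ) • a + (t : ℂ) • b, ⟨fun m => ?_, ?_⟩, ?_⟩
    · simp only [map_add, map_smul]
      exact add_nonneg (mul_nonneg (Complex.zero_le_real.2 hs) (ha.1 m))
        (mul_nonneg (Complex.zero_le_real.2 ht) (hb.1 m))
    · have h1 : (ι a : StrongDual ℂ (Elt M)) 1 = 1 := ha.2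
      have h2 : (ι b : StrongDual ℂ (Elt M)) 1 = 1 := hb.2
      rw [map_add, map_smul, map_smul]
      change (s : ℂ) * (ι a : StrongDual ℂ (Elt M)) 1 + (t : ℂ) * (ι b : StrongDual ℂ (Elt M)) 1 = 1
      rw [h1, h2, mul_one, mul_one]
      exact_mod_cast hst
    · rw [map_add, map_smul, map_smul]
      rfl
  · intro m s hms
    -- Vector states suffice: if `Re ⟪ξ, m ξ⟫ < s` for all unit `ξ`, then `2s - (m + m*)` is
    -- positive, hence of the form `k* k`, and applying `p` gives `Re p(m) ≤ s`.
    replace hms : ∀ ξ : H, ‖ξ‖ = 1 → (⟪ξ, (m : H →L[ℂ] H) ξ⟫_ℂ).re < s := fun ξ hξ => by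
      have := hms (vectorElt ι ξ ξ) (by
        have h : (ι (vectorElt ι ξ ξ) : StrongDual ℂ (Elt M)) = vectorFunctional M ξ ξ := by
          ext; simp
        simpa [h] using isState_vectorFunctional hξ)
      simpa using this
    obtain ⟨k, hk⟩ := exists_star_mul_self
      (h := ((2 * s : ℝ) : ℂ) • (1 : Elt M) - (m + star m)) (fun ξ => by
        have h1 : ⟪ξ, ((star m : Elt M) : H →L[ℂ] H) ξ⟫_ℂ =
            starRingEnd ℂ ⟪ξ, (m : H →L[ℂ] H) ξ⟫_ℂ := by
          rw [inner_conj_symm, ← ContinuousLinearMap.adjoint_inner_right]; rfl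
        have h2 : (⟪ξ, (m : H →L[ℂ] H) ξ⟫_ℂ).re ≤ s * ‖ξ‖ ^ 2 := by
          rcases eq_or_ne ξ 0 with rfl | h0
          · simp
          have hn : ‖ξ‖ ≠ 0 := norm_ne_zero_iff.2 h0
          have h3 := (hms (((‖ξ‖⁻¹ : ℝ) : ℂ) • ξ) (by
            rw [norm_smul, Complex.norm_real, norm_inv, norm_norm, inv_mul_cancel₀ hn])).le
          rw [map_smul, inner_smul_left, inner_smul_right, Complex.conj_ofReal,
            Complex.re_ofReal_mul, Complex.re_ofReal_mul] at h3
          have h4 := mul_le_mul_of_nonneg_right h3 (sq_nonneg ‖ξ‖)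
          field_simp at h4
          linarith
        have h5 : ⟪ξ, ((((2 * s : ℝ) : ℂ) • (1 : Elt M) - (m + star m) : Elt M) : H →L[ℂ] H) ξ⟫_ℂ =
            ((2 * s : ℝ) : ℂ) * ⟪ξ, ξ⟫_ℂ - (⟪ξ, (m : H →L[ℂ] H) ξ⟫_ℂ +
              starRingEnd ℂ ⟪ξ, (m : H →L[ℂ] H) ξ⟫_ℂ) := by
          rw [← h1, ← inner_smul_right, ← inner_add_right, ← inner_sub_right]; rfl
        rw [h5, Complex.add_conj, inner_self_eq_norm_sq_to_K]
        have h6 : (0 : ℝ) ≤ 2 * s * ‖ξ‖ ^ 2 - 2 * (⟪ξ, (m : H →L[ℂ] H) ξ⟫_ℂ).re := by linarith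
        refine (Complex.zero_le_real.2 h6).trans_eq ?_
        push_cast
        rfl)
    have h1 := (Complex.nonneg_iff.1 (hp.1 k)).1
    rw [← hk] at h1
    simp [hp.2, hp.re_star] at h1
    change (p m).re ≤ s
    linarith

end VonNeumannAlgebra

/-! ### From invariant states to fixed points and back. -/

section AmenabilityFixedPoints

open Filter

set_option maxSynthPendingDepth 3

variable {H : Type u} [NormedAddCommGroup H] [InnerProductSpace ℂ H] [CompleteSpace H]
variable {M : VonNeumannAlgebra H} {G : Type v} [Group G]
variable {α : G →* (Elt M ≃⋆ₐ[ℂ] Elt M)}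
variable {A : Type w} [NonUnitalNormedRing A] [NormedSpace ℂ A] {ι : A ≃ₗᵢ[ℂ] predual M}
variable {X : Type*} [NormedAddCommGroup X] [NormedSpace ℂ X]

/-- The map sending a functional `f` to `a ↦ (ξ ↦ f (a ξ))`. -/
def dualAction (aact : A →L[ℂ] X →L[ℂ] X) :
    StrongDual ℂ X →L[ℂ] A →L[ℂ] StrongDual ℂ X :=
  ((ContinuousLinearMap.compL ℂ A (X →L[ℂ] X) (StrongDual ℂ X)).flip aact).comp
    (ContinuousLinearMap.compL ℂ X X ℂ)

/-- The extension of `a ↦ T_a` from `A` to functionals on the dual of `A`. -/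
def arensOperator (aact : A →L[ℂ] X →L[ℂ] X) (P : StrongDual ℂ (StrongDual ℂ A)) :
    Bidual X →L[ℂ] Bidual X :=
  (ContinuousLinearMap.compL ℂ (StrongDual ℂ X) (StrongDual ℂ A) ℂ P).comp
    (((ContinuousLinearMap.compL ℂ (StrongDual ℂ X) (A →L[ℂ] StrongDual ℂ X)
      (StrongDual ℂ A)).flip (dualAction aact)).comp
        (ContinuousLinearMap.compL ℂ A (StrongDual ℂ X) ℂ))

theorem arensOperator_apply (aact : A →L[ℂ] X →L[ℂ] X) (P : StrongDual ℂ (StrongDual ℂ A))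
    (n : Bidual X) (f : StrongDual ℂ X) :
    arensOperator aact P n f = P (n.comp (dualAction aact f)) := rfl

/-- A whole projective series thus collapses to one functional on `A`, so weak*-convergence of
operators is tested on single elements of `M`. -/
theorem summable_comp_dualAction (aact : A →L[ℂ] X →L[ℂ] X) (q : ProjSeries X) :
    Summable fun n => (q.1.1 n).comp (dualAction aact (q.1.2 n)) := by
  refine Summable.of_norm_bounded (g := fun n => ‖dualAction aact‖ * (‖q.1.1 n‖ * ‖q.1.2 n‖))
    (q.2.mul_left _) fun n => ?_
  calc ‖(q.1.1 n).comp (dualAction aact (q.1.2 n))‖ ≤ ‖q.1.1 n‖ * ‖dualAction aact (q.1.2 n)‖ :=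
        ContinuousLinearMap.opNorm_comp_le _ _
    _ ≤ ‖q.1.1 n‖ * (‖dualAction aact‖ * ‖q.1.2 n‖) := by
        gcongr; exact ContinuousLinearMap.le_opNorm _ _
    _ = _ := by ring

theorem arensOperator_mem_PSet (aact : A →L[ℂ] X →L[ℂ] X) {p : StrongDual ℂ (Elt M)}
    (hp : IsState p) : arensOperator aact (p.comp (ofDual ι)) ∈ PSet ι fun a => aact a := by
  obtain ⟨F, hF, hS, hlim⟩ := exists_filter_normalStates ι hp
  refine @mem_closure_of_tendsto _ (weakStarTopology X) _ _ _ (fun a => bitranspose (aact a)) F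
    hF ?_ (hS.mono fun a ha => ⟨a, ha, rfl⟩)
  rw [nhds_induced, tendsto_comap_iff, tendsto_pi_nhds]
  intro q
  have hs := (summable_comp_dualAction aact q).hasSum
  set Φ := ∑' n, (q.1.1 n).comp (dualAction aact (q.1.2 n))
  have h1 : ∑' n, arensOperator aact (p.comp (ofDual ι)) (q.1.1 n) (q.1.2 n) =
      p (ofDual ι Φ) := (hs.mapL (p.comp (ofDual ι))).tsum_eq
  rw [h1]
  refine (hlim (ofDual ι Φ)).congr fun a => ?_
  rw [apply_ofDual]
  exact (hs.mapL (ContinuousLinearMap.apply ℂ ℂ a)).tsum_eq.symm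

/-- An invariant state gives a fixed point in every space with covariant actions of `G`
and `A`. -/
theorem hasGAFixedPoint_of_isGAmenable {β : G → A →L[ℂ] A}
    (hβ : ∀ (x : G) (a : A) (m : Elt M),
      (ι (β x a) : StrongDual ℂ (Elt M)) m = (ι a : StrongDual ℂ (Elt M)) (α x⁻¹ m))
    (h : IsGAmenable α) (gact : G → X →L[ℂ] X) (aact : A →L[ℂ] X →L[ℂ] X)
    (hcov : ∀ x a ξ, aact (β x a) ξ = gact x (aact a (gact x⁻¹ ξ))) :
    HasGAFixedPoint ι gact fun a => aact a := by
  obtain ⟨p, hp, hinv⟩ := h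
  refine ⟨_, arensOperator_mem_PSet aact hp, fun x => ?_⟩
  ext n f
  change arensOperator aact (p.comp (ofDual ι)) (bitranspose (gact x⁻¹) n) (f.comp (gact x)) = _
  rw [arensOperator_apply, arensOperator_apply]
  change p (ofDual ι _) = p (ofDual ι _)
  -- If `m` represents the functional `Φ` attached to `(n, f)`, covariance shows that conjugation by
  -- `T_x` replaces `Φ` by `Φ ∘ β_x`, which `α_{x⁻¹}(m)` represents.
  refine Eq.trans ?_ (hinv x _)
  refine congrArg p (elt_ext ι fun a => ?_)
  rw [← hβ, apply_ofDual, apply_ofDual]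
  change n _ = n _
  refine congrArg n (ContinuousLinearMap.ext fun ξ => ?_)
  exact congrArg f (hcov x a ξ).symm

/-- Matrix coefficients are weak*-continuous. -/
theorem continuous_coefficient (n : Bidual X) (f : StrongDual ℂ X) :
    @Continuous _ _ (weakStarTopology X) _ fun T : Bidual X →L[ℂ] Bidual X => T n f := by
  let q : ProjSeries X := ⟨(Pi.single 0 n, Pi.single 0 f),
    summable_of_ne_finset_zero (s := {0}) fun k hk => by
      simp [Pi.single_eq_of_ne (by simpa using hk : k ≠ 0)]⟩
  have h : (fun T : Bidual X →L[ℂ] Bidual X => T n f) =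
      (fun φ : ProjSeries X → ℂ => φ q) ∘
        fun T (p : ProjSeries X) => ∑' k, T (p.1.1 k) (p.1.2 k) := by
    ext T
    change T n f = ∑' k, T (q.1.1 k) (q.1.2 k)
    rw [tsum_eq_single 0 fun k hk => by simp [q, hk]]
    simp [q]
  rw [h]
  exact @Continuous.comp _ _ _ (weakStarTopology X) _ _ _ _ (continuous_apply q)
    continuous_induced_dom

/-- The device by which weak*-closed properties of the operators `T_a` pass to a fixed point. -/
theorem PSet_subset {aact : A → X →L[ℂ] X} {C : Set (Bidual X →L[ℂ] Bidual X)}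
    (hC : IsClosed[weakStarTopology X] C)
    (h : ∀ a : A, IsState (ι a : StrongDual ℂ (Elt M)) → bitranspose (aact a) ∈ C) :
    PSet ι aact ⊆ C :=
  @closure_minimal _ (weakStarTopology X) _ _ (by rintro _ ⟨a, ha, rfl⟩; exact h a ha) hC

/-- If the orbit of a vector `ξ` and a bounded family of functionals recover the pairing of `A`
with `M`, then a fixed point gives an invariant state. -/
theorem isGAmenable_of_hasGAFixedPoint {gact : G → X →L[ℂ] X} {aact : A → X →L[ℂ] X}
    (h : HasGAFixedPoint ι gact aact) (ξ : X) (F : Elt M →L[ℂ] StrongDual ℂ X)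
    (h1 : ∀ a m, F m (aact a ξ) = (ι a : StrongDual ℂ (Elt M)) m)
    (hx : ∀ x a m, F m (aact a (gact x ξ)) = (ι a : StrongDual ℂ (Elt M)) m)
    (hF : ∀ x m, (F m).comp (gact x) = F (α x⁻¹ m)) : IsGAmenable α := by
  obtain ⟨T, hT, hfix⟩ := h
  let J := NormedSpace.inclusionInDoubleDual ℂ X
  have hJ : ∀ a ζ m, bitranspose (aact a) (J ζ) (F m) = F m (aact a ζ) := fun a ζ m => rfl
  refine ⟨(T (J ξ)).comp F, ⟨fun m => ?_, ?_⟩, fun x m => ?_⟩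
  · refine PSet_subset (C := {T | 0 ≤ T (J ξ) (F (star m * m))}) ?_ ?_ hT
    · exact @IsClosed.preimage _ _ (weakStarTopology X) _ _
        (continuous_coefficient _ _) _ isClosed_Ici
    · intro a ha
      rw [Set.mem_ofPred_eq, hJ, h1]
      exact ha.1 m
  · refine PSet_subset (C := {T | T (J ξ) (F 1) = 1}) ?_ ?_ hT
    · exact @IsClosed.preimage _ _ (weakStarTopology X) _ _
        (continuous_coefficient _ _) _ isClosed_singleton
    · intro a ha
      rw [Set.mem_ofPred_eq, hJ, h1]
      exact ha.2
  · have h2 : T (J (gact x⁻¹ ξ)) (F (α x⁻¹ m)) = T (J ξ) (F (α x⁻¹ m)) := by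
      refine PSet_subset
        (C := {T | T (J (gact x⁻¹ ξ)) (F (α x⁻¹ m)) = T (J ξ) (F (α x⁻¹ m))}) ?_ ?_ hT
      · exact @isClosed_eq _ _ _ (weakStarTopology X) _ _ _
          (continuous_coefficient _ _) (continuous_coefficient _ _)
      · intro a ha
        rw [Set.mem_ofPred_eq, hJ, hJ, h1, hx]
    change T (J ξ) (F (α x⁻¹ m)) = T (J ξ) (F m)
    rw [← h2, ← hF]
    exact congrArg (fun S : Bidual X →L[ℂ] Bidual X => S (J ξ) (F m)) (hfix x)

end AmenabilityFixedPoints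

/-! ### Weakly continuous actions by contractions are norm continuous. -/

section WeakContinuity

open Filter

set_option maxSynthPendingDepth 3

variable {Z : Type*} [TopologicalSpace Z] {E : Type*} [NormedAddCommGroup E] [NormedSpace ℂ E]

/-- Closed balls are weakly closed. -/
theorem isClosed_preimage_closedBall {f : Z → E}
    (hf : ∀ φ : StrongDual ℂ E, Continuous fun z => φ (f z)) (c : E) (r : ℝ) :
    IsClosed {z | ‖f z - c‖ ≤ r} := by
  by_cases hr : 0 ≤ r
  · have : {z | ‖f z - c‖ ≤ r} =
        ⋂ φ : {φ : StrongDual ℂ E // ‖φ‖ ≤ 1}, {z | ‖φ.1 (f z) - φ.1 c‖ ≤ r} := by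
      ext z
      simp only [Set.mem_ofPred_eq, Set.mem_iInter, Subtype.forall, ← map_sub]
      refine ⟨fun h φ hφ => ?_, fun h => ?_⟩
      · exact (φ.le_opNorm _).trans ((mul_le_of_le_one_left (norm_nonneg _) hφ).trans h)
      · obtain ⟨g, hg, hg'⟩ := exists_dual_vector'' ℂ (f z - c)
        have := h g hg
        rw [hg'] at this
        simpa using this
    rw [this]
    exact isClosed_iInter fun φ => isClosed_le ((hf φ.1).sub continuous_const).norm continuous_const
  · have : {z | ‖f z - c‖ ≤ r} = ∅ :=
      Set.eq_empty_of_forall_notMem fun z hz => hr ((norm_nonneg _).trans hz)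
    rw [this]
    exact isClosed_empty

/-- If a bounded weakly continuous function sends no nonempty open set to a ball of radius `ε`, then
every nonempty open set contains points sent far from a given finite dimensional subspace. -/
theorem exists_le_norm_sub {f : Z → E} (hf : ∀ φ : StrongDual ℂ E, Continuous fun z => φ (f z))
    {C : ℝ} (hC : ∀ z, ‖f z‖ ≤ C) {ε : ℝ} (hε : 0 < ε)
    (hosc : ∀ V : Set Z, IsOpen V → V.Nonempty → ∀ c, ∃ z ∈ V, ε < ‖f z - c‖)
    (D : Submodule ℂ E) [FiniteDimensional ℂ D] {U : Set Z} (hU : IsOpen U) (hne : U.Nonempty) :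
    ∃ z ∈ U, ∀ d ∈ D, ε / 2 ≤ ‖f z - d‖ := by
  by_contra! hcon
  -- If `f(U)` were within `ε/2` of `D`, an `ε/2`-net of this compact ball would cover `U` by
  -- finitely many closed sets, each with empty interior by `hosc`.
  have hK : IsCompact (Subtype.val '' Metric.closedBall (0 : D) (C + ε)) := by
    have : ProperSpace D := FiniteDimensional.proper ℂ D
    exact (isCompact_closedBall _ _).image continuous_subtype_val
  obtain ⟨t, -, htfin, ht⟩ := Metric.finite_approx_of_totallyBounded hK.totallyBounded (ε / 2)
    (by positivity)
  have hcover : U ⊆ ⋃ c ∈ t, {z | ‖f z - c‖ ≤ ε} := by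
    intro z hz
    obtain ⟨d, hd, hzd⟩ := hcon z hz
    have hdn : ‖d‖ ≤ C + ε := by
      have := norm_sub_norm_le d (f z)
      rw [norm_sub_rev] at this
      linarith [hC z]
    have hdK : d ∈ Subtype.val '' Metric.closedBall (0 : D) (C + ε) :=
      ⟨⟨d, hd⟩, by simpa using hdn, rfl⟩
    obtain ⟨c, hc, hdc⟩ := Set.mem_iUnion₂.1 (ht hdK)
    refine Set.mem_iUnion₂.2 ⟨c, hc, ?_⟩
    rw [Metric.mem_ball, dist_eq_norm] at hdc
    have := norm_sub_le_norm_sub_add_norm_sub (f z) d c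
    simp only [Set.mem_ofPred_eq]
    linarith
  have hint : ∀ c ∈ t, interior {z | ‖f z - c‖ ≤ ε} = ∅ := by
    intro c _
    by_contra hne'
    obtain ⟨z, hz, hlt⟩ := hosc _ isOpen_interior (Set.nonempty_iff_ne_empty.2 hne') c
    exact absurd (interior_subset hz) (not_le.2 hlt)
  have hempty : interior (⋃ c ∈ t, {z | ‖f z - c‖ ≤ ε}) = ∅ := by
    clear hcover ht
    induction t, htfin using Set.Finite.induction_on with
    | empty => simp
    | @insert a s _ _ ih =>
      rw [Set.biUnion_insert, interior_union_isClosed_of_interior_empty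
        (isClosed_preimage_closedBall hf a ε)
        (ih fun c hc => hint c (Set.mem_insert_of_mem _ hc))]
      exact hint a (Set.mem_insert _ _)
  have := interior_maximal hcover hU
  rw [hempty] at this
  exact hne.ne_empty (Set.subset_empty_iff.1 this)

/-- A vector at distance at least `r` from a subspace is separated from it by a functional. -/
theorem exists_dual_eq_zero_of_le (D : Submodule ℂ E) {r : ℝ} {x : E}
    (h : ∀ d ∈ D, r ≤ ‖x - d‖) :
    ∃ φ : StrongDual ℂ E, ‖φ‖ ≤ 1 ∧ (∀ d ∈ D, φ d = 0) ∧ r ≤ ‖φ x‖ := by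
  obtain ⟨g, hg, hgx⟩ := exists_dual_vector'' ℂ (D.mkQ x)
  refine ⟨g.comp D.mkQL, ?_, fun d hd => ?_, ?_⟩
  · refine ContinuousLinearMap.opNorm_le_bound _ zero_le_one fun y => ?_
    refine (g.le_opNorm _).trans ?_
    exact mul_le_mul hg (Submodule.Quotient.norm_mk_le D y) (norm_nonneg _) zero_le_one
  · have : D.mkQ d = 0 := by simpa using hd
    simp [this]
  · rw [ContinuousLinearMap.comp_apply, Submodule.mkQL_apply, hgx]
    simp only [RCLike.norm_ofReal, abs_norm]
    refine le_of_forall_pos_lt_add fun δ hδ => ?_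
    obtain ⟨y, hy, hlt⟩ := Submodule.Quotient.norm_mk_lt (S := D) (D.mkQ x) hδ
    have hd : x - y ∈ D := (Submodule.Quotient.eq D).1 hy.symm
    have := h _ hd
    rw [sub_sub_cancel] at this
    exact this.trans_lt hlt

/-- A bounded weakly continuous function on a locally compact space sends some nonempty open set to
a small ball. -/
theorem exists_isOpen_norm_sub_le [LocallyCompactSpace Z] [T2Space Z] [Nonempty Z] {f : Z → E}
    (hf : ∀ φ : StrongDual ℂ E, Continuous fun z => φ (f z)) {C : ℝ} (hC : ∀ z, ‖f z‖ ≤ C)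
    {ε : ℝ} (hε : 0 < ε) :
    ∃ V : Set Z, IsOpen V ∧ V.Nonempty ∧ ∃ c, ∀ z ∈ V, ‖f z - c‖ ≤ ε := by
  by_contra! hosc
  -- Inductive step: pick `z ∈ U` with `f z` at distance at least `ε/2` from `D`, and a functional
  -- vanishing on `D` that detects this. By continuity it keeps modulus at least `ε/4` on a smaller
  -- neighbourhood; then `f z` is added to `D`. A cluster point of the chosen points is sent away
  -- from the union of the subspaces, yet to a weak limit of its elements.
  have step : ∀ S : {S : Set Z × Submodule ℂ E //
        IsOpen S.1 ∧ S.1.Nonempty ∧ FiniteDimensional ℂ S.2},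
      ∃ (S' : {S : Set Z × Submodule ℂ E // IsOpen S.1 ∧ S.1.Nonempty ∧ FiniteDimensional ℂ S.2})
        (z : Z) (φ : StrongDual ℂ E), S.1.2 ≤ S'.1.2 ∧ f z ∈ S'.1.2 ∧ z ∈ S.1.1 ∧
        closure S'.1.1 ⊆ S.1.1 ∧ IsCompact (closure S'.1.1) ∧ ‖φ‖ ≤ 1 ∧ (∀ d ∈ S.1.2, φ d = 0) ∧
        ∀ y ∈ closure S'.1.1, ε / 4 ≤ ‖φ (f y)‖ := by
    rintro ⟨⟨U, D⟩, hU, hne, hD⟩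
    obtain ⟨z, hzU, hz⟩ := exists_le_norm_sub hf hC hε hosc D hU hne
    obtain ⟨φ, hφ, hφD, hφz⟩ := exists_dual_eq_zero_of_le D hz
    have hcont : Continuous fun y => ‖φ (f y)‖ := (hf φ).norm
    obtain ⟨K, hK, hzK, hKU⟩ := exists_compact_subset
      (hU.inter (isOpen_lt continuous_const hcont)) (x := z)
      ⟨hzU, show ε / 4 < ‖φ (f z)‖ by linarith⟩
    have hcl : closure (interior K) ⊆ K := closure_minimal interior_subset hK.isClosed
    refine ⟨⟨⟨interior K, D ⊔ Submodule.span ℂ {f z}⟩, isOpen_interior, ⟨z, hzK⟩, ?_⟩, z, φ,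
      le_sup_left, ?_, hzU, fun y hy => (hKU (hcl hy)).1,
      hK.of_isClosed_subset isClosed_closure hcl, hφ, hφD,
      fun y hy => (hKU (hcl hy)).2.le⟩
    · exact Submodule.finiteDimensional_sup _ _
    · exact Submodule.mem_sup_right (Submodule.mem_span_singleton_self _)
  choose next pt φ hle hmem hpt hclos hcomp hφ hφ0 hφε using step
  let st : ℕ → {S : Set Z × Submodule ℂ E //
      IsOpen S.1 ∧ S.1.Nonempty ∧ FiniteDimensional ℂ S.2} :=
    fun n => next^[n] ⟨⟨Set.univ, ⊥⟩, isOpen_univ, Set.univ_nonempty, inferInstance⟩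
  have hst : ∀ n, st (n + 1) = next (st n) := fun n => Function.iterate_succ_apply' _ _ _
  have hmonoD : Monotone fun n => (st n).1.2 := monotone_nat_of_le_succ fun n => by
    rw [hst]; exact hle _
  have hantiU : Antitone fun n => (st n).1.1 := antitone_nat_of_succ_le fun n => by
    rw [hst]; exact subset_closure.trans (hclos _)
  -- The tails start at `n + 1` because the initial open set is the whole space; only later ones
  -- have compact closure.
  let K : ℕ → Set Z := fun n => closure ((fun k => pt (st k)) '' Set.Ici (n + 1))
  have hKU : ∀ n, K n ⊆ closure (st (n + 1)).1.1 := fun n => by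
    refine closure_mono ?_
    rintro _ ⟨k, hk, rfl⟩
    exact hantiU hk (hpt _)
  obtain ⟨z, hz⟩ := IsCompact.nonempty_iInter_of_sequence_nonempty_isCompact_isClosed K
    (fun n => closure_mono (Set.image_mono (Set.Ici_subset_Ici.2 (by omega))))
    (fun n => ⟨_, subset_closure ⟨n + 1, Set.mem_Ici.2 le_rfl, rfl⟩⟩)
    ((by rw [hst]; exact hcomp _ : IsCompact (closure (st 1).1.1)).of_isClosed_subset
      isClosed_closure (hKU 0))
    (fun n => isClosed_closure)
  rw [Set.mem_iInter] at hz
  have hbig : ∀ n, ∀ d ∈ (st n).1.2, ε / 4 ≤ ‖f z - d‖ := fun n d hd => by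
    have h1 : z ∈ closure (next (st n)).1.1 := by rw [← hst]; exact hKU n (hz n)
    have h2 := hφε _ z h1
    rw [← sub_zero (φ (st n) (f z)), ← hφ0 _ d hd, ← map_sub] at h2
    exact h2.trans (((φ (st n)).le_opNorm _).trans
      (mul_le_of_le_one_left (norm_nonneg _) (hφ _)))
  obtain ⟨ψ, -, hψ0, hψ⟩ := exists_dual_eq_zero_of_le (⨆ n, (st n).1.2) (x := f z) (r := ε / 4)
    fun d hd => by
      obtain ⟨n, hn⟩ := (Submodule.mem_iSup_of_directed _ hmonoD.directed_le).1 hd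
      exact hbig n d hn
  have hψz : ψ (f z) = 0 := by
    have : K 0 ⊆ {y | ψ (f y) = 0} := by
      refine closure_minimal ?_ (isClosed_eq (hf ψ) continuous_const)
      rintro _ ⟨k, -, rfl⟩
      refine hψ0 _ (Submodule.mem_iSup_of_mem (k + 1) ?_)
      rw [hst]
      exact hmem _
    exact this (hz 0)
  rw [hψz, norm_zero] at hψ
  linarith

/-- A weakly continuous action of a locally compact group by contractions is norm continuous. -/
theorem continuous_of_weakly_continuous {G : Type*} [Group G] [TopologicalSpace G]
    [IsTopologicalGroup G] [LocallyCompactSpace G] [T2Space G] (b : G → E →L[ℂ] E)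
    (hmul : ∀ x y a, b (x * y) a = b x (b y a))
    (hnorm : ∀ x a, ‖b x a‖ ≤ ‖a‖)
    (hweak : ∀ (a : E) (φ : StrongDual ℂ E), Continuous fun x => φ (b x a)) (a : E) :
    Continuous fun x => b x a := by
  rw [continuous_iff_continuousAt]
  intro x₀
  rw [ContinuousAt, Metric.tendsto_nhds]
  intro ε hε
  obtain ⟨V, hV, ⟨v, hv⟩, c, hc⟩ := exists_isOpen_norm_sub_le (hweak a) (fun x => hnorm x a)
    (ε := ε / 3) (by positivity)
  have hcont : Continuous fun x : G => v * x₀⁻¹ * x := continuous_const.mul continuous_id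
  filter_upwards [(hV.preimage hcont).mem_nhds (by simpa using hv : x₀ ∈ _ ⁻¹' V)] with x hx
  -- The contraction `b (x₀ * v⁻¹)` transports the small oscillation near `v` to `x₀`; two errors of
  -- `ε / 3` remain below `ε`.
  have h1 : b x a - b x₀ a = b (x₀ * v⁻¹) (b (v * x₀⁻¹ * x) a - b v a) := by
    rw [map_sub, ← hmul, ← hmul]
    congr 2 <;> group
  rw [dist_eq_norm, h1]
  refine (hnorm _ _).trans_lt ?_
  have h2 := norm_sub_le_norm_sub_add_norm_sub (b (v * x₀⁻¹ * x) a) c (b v a)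
  have h3 := hc _ hx
  have h4 := hc _ hv
  rw [norm_sub_rev] at h4
  linarith

end WeakContinuity

/-! ### The pre-adjoint action and the module `A¹`. -/

section UnitizationModules

set_option maxSynthPendingDepth 3

variable {H : Type u} [NormedAddCommGroup H] [InnerProductSpace ℂ H] [CompleteSpace H]
variable {M : VonNeumannAlgebra H} {G : Type v} [Group G]
variable {α : G →* (Elt M ≃⋆ₐ[ℂ] Elt M)}
variable {A : Type w} [NonUnitalNormedRing A] [NormedSpace ℂ A]

section Preadjoint

variable {ι : A ≃ₗᵢ[ℂ] predual M} {β : G → A →L[ℂ] A}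

theorem preadjoint_mul (hβ : ∀ (x : G) (a : A) (m : Elt M),
      (ι (β x a) : StrongDual ℂ (Elt M)) m = (ι a : StrongDual ℂ (Elt M)) (α x⁻¹ m))
    (x y : G) (a : A) : β (x * y) a = β x (β y a) :=
  predual_ext ι fun m => by
    rw [hβ, hβ, hβ, mul_inv_rev, map_mul]
    rfl

theorem preadjoint_one (hβ : ∀ (x : G) (a : A) (m : Elt M),
      (ι (β x a) : StrongDual ℂ (Elt M)) m = (ι a : StrongDual ℂ (Elt M)) (α x⁻¹ m))
    (a : A) : β 1 a = a :=
  predual_ext ι fun m => by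
    rw [hβ, inv_one, map_one]
    rfl

theorem norm_preadjoint_le (hβ : ∀ (x : G) (a : A) (m : Elt M),
      (ι (β x a) : StrongDual ℂ (Elt M)) m = (ι a : StrongDual ℂ (Elt M)) (α x⁻¹ m))
    (x : G) (a : A) : ‖β x a‖ ≤ ‖a‖ := by
  rw [← ι.norm_map, ← ι.norm_map a]
  refine ContinuousLinearMap.opNorm_le_bound _ (norm_nonneg _) fun m => ?_
  change ‖(ι (β x a) : StrongDual ℂ (Elt M)) m‖ ≤ _
  rw [hβ]
  refine (ContinuousLinearMap.le_opNorm _ _).trans_eq ?_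
  rw [norm_starAlgEquiv_apply]
  rfl

/-- As every functional on `A` comes from `M`, the hypothesis on `α` says that `β` is weakly
continuous. -/
theorem continuous_preadjoint [TopologicalSpace G] [IsTopologicalGroup G] [LocallyCompactSpace G]
    [T2Space G] (hβ : ∀ (x : G) (a : A) (m : Elt M),
      (ι (β x a) : StrongDual ℂ (Elt M)) m = (ι a : StrongDual ℂ (Elt M)) (α x⁻¹ m))
    (hα : ∀ (m : Elt M), ∀ φ ∈ predual M, Continuous fun x => φ (α x m)) (a : A) :
    Continuous fun x => β x a := by
  refine continuous_of_weakly_continuous β (preadjoint_mul hβ) (norm_preadjoint_le hβ)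
    (fun a φ => ?_) a
  have h : (fun x => φ (β x a)) =
      (fun x => (ι a : StrongDual ℂ (Elt M)) (α x (ofDual ι φ))) ∘ fun x => x⁻¹ := by
    ext x
    rw [Function.comp_apply, ← hβ, apply_ofDual]
  rw [h]
  exact (hα _ _ (ι a).2).comp continuous_inv

end Preadjoint

variable [IsScalarTower ℂ A A] [SMulCommClass ℂ A A]

variable (A) in
/-- The inclusion of `A` in its unitization. -/
def unit1Inr : A →L[ℂ] Unit1 A :=
  LinearMap.mkContinuous
    { toFun := fun a => WithLp.toLp 1 (a : Unitization ℂ A)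
      map_add' := fun a b => by
        apply (WithLp.equiv 1 (Unitization ℂ A)).injective; simp
      map_smul' := fun c a => by
        apply (WithLp.equiv 1 (Unitization ℂ A)).injective; simp }
    1 (fun a => by simp [WithLp.unitization_norm_inr])

variable (A) in
/-- The projection of the unitization onto `A`. -/
def unit1Snd : Unit1 A →L[ℂ] A :=
  LinearMap.mkContinuous
    { toFun := fun z => (WithLp.ofLp z).snd
      map_add' := fun y z => by simp
      map_smul' := fun c z => by simp }
    1 (fun z => by
      rw [one_mul, WithLp.unitization_norm_def]
      exact le_add_of_nonneg_left (norm_nonneg _))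

variable (A) in
/-- The action of `A` on its unitization, as a bounded bilinear map. -/
def unit1MulL : A →L[ℂ] Unit1 A →L[ℂ] Unit1 A :=
  (ContinuousLinearMap.mul ℂ (Unit1 A)).comp (unit1Inr A)

theorem unit1_ext {B : Type w} {y z : Unit1 B} (h1 : (WithLp.ofLp y).fst = (WithLp.ofLp z).fst)
    (h2 : (WithLp.ofLp y).snd = (WithLp.ofLp z).snd) : y = z :=
  (WithLp.equiv 1 (Unitization ℂ B)).injective (Unitization.ext h1 h2)

@[simp]
theorem fst_unit1Map (b : A →L[ℂ] A) (z : Unit1 A) :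
    (WithLp.ofLp (unit1Map b z)).fst = (WithLp.ofLp z).fst := by
  change (Unitization.inl (WithLp.ofLp z).fst + Unitization.inr (b (WithLp.ofLp z).snd) :
    Unitization ℂ A).fst = _
  simp

@[simp]
theorem snd_unit1Map (b : A →L[ℂ] A) (z : Unit1 A) :
    (WithLp.ofLp (unit1Map b z)).snd = b (WithLp.ofLp z).snd := by
  change (Unitization.inl (WithLp.ofLp z).fst + Unitization.inr (b (WithLp.ofLp z).snd) :
    Unitization ℂ A).snd = _
  simp

@[simp]
theorem fst_unit1Mul (a : A) (z : Unit1 A) : (WithLp.ofLp (unit1Mul a z)).fst = 0 := by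
  change ((a : Unitization ℂ A) * WithLp.ofLp z).fst = _
  simp

@[simp]
theorem snd_unit1Mul (a : A) (z : Unit1 A) : (WithLp.ofLp (unit1Mul a z)).snd =
    (WithLp.ofLp z).fst • a + a * (WithLp.ofLp z).snd := by
  change ((a : Unitization ℂ A) * WithLp.ofLp z).snd = _
  simp

@[simp]
theorem fst_ofLp_one : (WithLp.ofLp (1 : Unit1 A)).fst = 1 := rfl

@[simp]
theorem snd_ofLp_one : (WithLp.ofLp (1 : Unit1 A)).snd = 0 := rfl

/-- The functionals on the unitization vanishing at the identity, indexed by `M`. -/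
def unit1Pairing (ι : A ≃ₗᵢ[ℂ] predual M) : Elt M →L[ℂ] StrongDual ℂ (Unit1 A) :=
  ((ContinuousLinearMap.compL ℂ (Unit1 A) A ℂ).flip (unit1Snd A)).comp
    (((predual M).subtypeL.comp (ι.toContinuousLinearEquiv : A →L[ℂ] predual M)).flip)

theorem unit1Pairing_apply (ι : A ≃ₗᵢ[ℂ] predual M) (m : Elt M) (z : Unit1 A) :
    unit1Pairing ι m z = (ι (WithLp.ofLp z).snd : StrongDual ℂ (Elt M)) m := rfl

section Covariance

variable {ι : A ≃ₗᵢ[ℂ] predual M} {β : G → A →L[ℂ] A}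

theorem unit1Pairing_unit1Map (hβ : ∀ (x : G) (a : A) (m : Elt M),
      (ι (β x a) : StrongDual ℂ (Elt M)) m = (ι a : StrongDual ℂ (Elt M)) (α x⁻¹ m))
    (x : G) (m : Elt M) (z : Unit1 A) :
    unit1Pairing ι m (unit1Map (β x) z) = unit1Pairing ι (α x⁻¹ m) z := by
  rw [unit1Pairing_apply, snd_unit1Map, hβ, unit1Pairing_apply]

theorem unit1Mul_covariant (hβ : ∀ (x : G) (a : A) (m : Elt M),
      (ι (β x a) : StrongDual ℂ (Elt M)) m = (ι a : StrongDual ℂ (Elt M)) (α x⁻¹ m))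
    (hβ_mul : ∀ (x : G) (a b : A), β x (a * b) = β x a * β x b) (x : G) (a : A) (z : Unit1 A) :
    unit1Mul (β x a) z = unit1Map (β x) (unit1Mul a (unit1Map (β x⁻¹) z)) := by
  refine unit1_ext (by simp) ?_
  simp [hβ_mul, ← preadjoint_mul hβ, preadjoint_one hβ]

/-- The unitization of `A`, moved to a larger universe, is a left Banach `G`-`A`-module. -/
def uliftUnit1Module [TopologicalSpace G] [IsTopologicalGroup G] [LocallyCompactSpace G]
    [T2Space G] (hα : ∀ (m : Elt M), ∀ φ ∈ predual M, Continuous fun x => φ (α x m))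
    (hβ : ∀ (x : G) (a : A) (m : Elt M),
      (ι (β x a) : StrongDual ℂ (Elt M)) m = (ι a : StrongDual ℂ (Elt M)) (α x⁻¹ m))
    (hβ_mul : ∀ (x : G) (a b : A), β x (a * b) = β x a * β x b) :
    BanachGAModule β (ULift.{v} (Unit1 A)) where
  gact x := ((ContinuousLinearEquiv.ulift (R₁ := ℂ) (M₁ := Unit1 A)).symm :
      Unit1 A →L[ℂ] ULift.{v} (Unit1 A)).comp ((unit1Map (β x)).comp
        ((ContinuousLinearEquiv.ulift (R₁ := ℂ) (M₁ := Unit1 A)) :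
          ULift.{v} (Unit1 A) →L[ℂ] Unit1 A))
  norm_gact_le x ξ := by
    change ‖unit1Map (β x) ξ.down‖ ≤ ‖ξ.down‖
    rw [WithLp.unitization_norm_def, WithLp.unitization_norm_def, fst_unit1Map, snd_unit1Map]
    gcongr
    exact norm_preadjoint_le hβ x _
  gact_mul x y ξ := ULift.ext _ _ (by
    change unit1Map (β (x * y)) ξ.down = unit1Map (β x) (unit1Map (β y) ξ.down)
    exact unit1_ext (by simp) (by simp [preadjoint_mul hβ]))
  continuous_gact ξ := by
    refine ContinuousLinearEquiv.ulift.symm.continuous.comp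
      (g := (ContinuousLinearEquiv.ulift (R₁ := ℂ) (M₁ := Unit1 A)).symm)
      (f := fun x => unit1Map (β x) ξ.down) ?_
    have h : (fun x => unit1Map (β x) ξ.down) = fun x =>
        (WithLp.ofLp ξ.down).fst • (1 : Unit1 A) + unit1Inr A (β x (WithLp.ofLp ξ.down).snd) := by
      ext x
      refine unit1_ext ?_ ?_
      · simp [unit1Inr]
      · simp [unit1Inr]
    rw [h]
    exact continuous_const.add
      ((unit1Inr A).continuous.comp (continuous_preadjoint hβ hα _))
  aact := (ContinuousLinearMap.compL ℂ (ULift.{v} (Unit1 A)) (Unit1 A) (ULift.{v} (Unit1 A))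
      ((ContinuousLinearEquiv.ulift (R₁ := ℂ) (M₁ := Unit1 A)).symm :
        Unit1 A →L[ℂ] ULift.{v} (Unit1 A))).comp
    (((ContinuousLinearMap.compL ℂ (ULift.{v} (Unit1 A)) (Unit1 A) (Unit1 A)).flip
      ((ContinuousLinearEquiv.ulift (R₁ := ℂ) (M₁ := Unit1 A)) :
        ULift.{v} (Unit1 A) →L[ℂ] Unit1 A)).comp (unit1MulL A))
  norm_aact_le a ξ := by
    change ‖WithLp.toLp 1 (a : Unitization ℂ A) * ξ.down‖ ≤ ‖a‖ * ‖ξ.down‖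
    rw [← WithLp.unitization_norm_inr (𝕜 := ℂ) a]
    exact norm_mul_le _ _
  aact_mul a b ξ := ULift.ext _ _ (by
    change unit1Mul (a * b) ξ.down = unit1Mul a (unit1Mul b ξ.down)
    exact unit1_ext (by simp) (by simp [mul_add, mul_assoc, mul_smul_comm]))
  covariant x a ξ := ULift.ext _ _ (unit1Mul_covariant hβ hβ_mul x a ξ.down)

/-- The test module is `A¹`, lifted to the universe over which the fixed point property quantifies.
-/
theorem isGAmenable_of_hasGFixedPointProperty [TopologicalSpace G] [IsTopologicalGroup G]
    [LocallyCompactSpace G] [T2Space G] [CompleteSpace A]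
    (hα : ∀ (m : Elt M), ∀ φ ∈ predual M, Continuous fun x => φ (α x m))
    (hβ : ∀ (x : G) (a : A) (m : Elt M),
      (ι (β x a) : StrongDual ℂ (Elt M)) m = (ι a : StrongDual ℂ (Elt M)) (α x⁻¹ m))
    (hβ_mul : ∀ (x : G) (a b : A), β x (a * b) = β x a * β x b)
    (h : HasGFixedPointProperty ι β) : IsGAmenable α := by
  refine isGAmenable_of_hasGAFixedPoint
    (h (ULift.{v} (Unit1 A)) (uliftUnit1Module hα hβ hβ_mul)) (ULift.up 1)
    (((ContinuousLinearMap.compL ℂ (ULift.{v} (Unit1 A)) (Unit1 A) ℂ).flip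
      ((ContinuousLinearEquiv.ulift (R₁ := ℂ) (M₁ := Unit1 A)) :
        ULift.{v} (Unit1 A) →L[ℂ] Unit1 A)).comp (unit1Pairing ι)) ?_ ?_ ?_
  · intro a m
    change unit1Pairing ι m (unit1Mul a 1) = _
    simp [unit1Pairing_apply]
  · intro x a m
    change unit1Pairing ι m (unit1Mul a (unit1Map (β x) 1)) = _
    simp [unit1Pairing_apply]
  · intro x m
    ext ξ
    exact unit1Pairing_unit1Map hβ x m ξ.down

theorem isGAmenable_of_hasGAFixedPoint_unit1
    (hβ : ∀ (x : G) (a : A) (m : Elt M),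
      (ι (β x a) : StrongDual ℂ (Elt M)) m = (ι a : StrongDual ℂ (Elt M)) (α x⁻¹ m))
    (h : HasGAFixedPoint ι (fun x => unit1Map (β x)) fun a : A => unit1Mul a) :
    IsGAmenable α :=
  isGAmenable_of_hasGAFixedPoint h 1 (unit1Pairing ι)
    (fun a m => by simp [unit1Pairing_apply]) (fun x a m => by simp [unit1Pairing_apply])
    (fun x m => ContinuousLinearMap.ext fun z => unit1Pairing_unit1Map hβ x m z)

end Covariance

end UnitizationModules

/-! ### The Bochner integral as an operator on `L¹`. -/

section BochnerIntegral

set_option maxSynthPendingDepth 3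

variable {S : Type*} [MeasurableSpace S] {E : Type*} [NormedAddCommGroup E] [NormedSpace ℂ E]

variable (E) in
/-- The Bochner integral as a bounded complex linear map on `L¹`. -/
def l1Integral (μ : Measure S) : Lp E 1 μ →L[ℂ] E :=
  LinearMap.mkContinuous
    { toFun := fun f => ∫ t, f t ∂μ
      map_add' := fun f g => by
        rw [← integral_add (L1.integrable_coeFn f) (L1.integrable_coeFn g)]
        exact integral_congr_ae (Lp.coeFn_add f g)
      map_smul' := fun c f => by
        rw [RingHom.id_apply, ← integral_smul]
        exact integral_congr_ae (Lp.coeFn_smul c f) }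
    1 (fun f => by
      rw [one_mul, L1.norm_eq_integral_norm]
      exact norm_integral_le_integral_norm _)

theorem l1Integral_apply (μ : Measure S) (f : Lp E 1 μ) : l1Integral E μ f = ∫ t, f t ∂μ := rfl

theorem l1Integral_compLpL [CompleteSpace E] (μ : Measure S) (L : E →L[ℂ] E) (f : Lp E 1 μ) :
    l1Integral E μ (L.compLpL 1 μ f) = L (l1Integral E μ f) := by
  rw [l1Integral_apply, l1Integral_apply, ← L.integral_comp_comm (L1.integrable_coeFn f)]
  exact L.integral_compLp f

end BochnerIntegral

/-! ### The module `L¹(G, A¹)`. -/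

section L1Module

set_option maxSynthPendingDepth 3

variable {H : Type u} [NormedAddCommGroup H] [InnerProductSpace ℂ H] [CompleteSpace H]
variable {M : VonNeumannAlgebra H}
variable {G : Type v} [Group G] [TopologicalSpace G] [IsTopologicalGroup G]
  [MeasurableSpace G] [BorelSpace G] (μ : Measure G) [μ.IsMulLeftInvariant]
variable {α : G →* (Elt M ≃⋆ₐ[ℂ] Elt M)}
variable {A : Type w} [NonUnitalNormedRing A] [NormedSpace ℂ A]
  [IsScalarTower ℂ A A] [SMulCommClass ℂ A A]
variable {ι : A ≃ₗᵢ[ℂ] predual M} {β : G → A →L[ℂ] A}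

theorem coeFn_l1GAct (x : G) (f : Lp (Unit1 A) 1 μ) :
    l1GAct μ β x f =ᵐ[μ] fun t => unit1Map (β x) (f (x⁻¹ * t)) := by
  refine ((unit1Map (β x)).coeFn_compLpL _).trans ?_
  filter_upwards [Lp.coeFn_compMeasurePreserving f (measurePreserving_mul_left μ x⁻¹)] with t ht
  exact congrArg _ ht

/-- Left invariance of the measure removes the translation under the integral. -/
theorem l1Integral_l1GAct [CompleteSpace A] (x : G) (f : Lp (Unit1 A) 1 μ) :
    l1Integral (Unit1 A) μ (l1GAct μ β x f) = unit1Map (β x) (l1Integral (Unit1 A) μ f) := by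
  rw [l1GAct, ContinuousLinearMap.comp_apply, l1Integral_compLpL, l1Integral_apply,
    l1Integral_apply]
  congr 1
  rw [← integral_mul_left_eq_self (fun t => f t) x⁻¹]
  exact integral_congr_ae
    (Lp.coeFn_compMeasurePreserving f (measurePreserving_mul_left μ x⁻¹))

theorem l1AAct_covariant (hβ : ∀ (x : G) (a : A) (m : Elt M),
      (ι (β x a) : StrongDual ℂ (Elt M)) m = (ι a : StrongDual ℂ (Elt M)) (α x⁻¹ m))
    (hβ_mul : ∀ (x : G) (a b : A), β x (a * b) = β x a * β x b) (x : G) (a : A)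
    (f : Lp (Unit1 A) 1 μ) :
    l1AAct μ (β x a) f = l1GAct μ β x (l1AAct μ a (l1GAct μ β x⁻¹ f)) := by
  refine Lp.ext ?_
  have h1 := (measurePreserving_mul_left μ x⁻¹).quasiMeasurePreserving.ae_eq_comp
    (((unit1Mul a).coeFn_compLpL (l1GAct μ β x⁻¹ f)))
  have h2 := (measurePreserving_mul_left μ x⁻¹).quasiMeasurePreserving.ae_eq_comp
    (coeFn_l1GAct μ (β := β) x⁻¹ f)
  filter_upwards [(unit1Mul (β x a)).coeFn_compLpL f,
    coeFn_l1GAct μ (β := β) x (l1AAct μ a (l1GAct μ β x⁻¹ f)), h1, h2] with t h3 h4 h5 h6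
  simp only [Function.comp_apply] at h5 h6
  rw [l1AAct, h3, h4, l1AAct, h5, h6, inv_inv, mul_inv_cancel_left, unit1Mul_covariant hβ hβ_mul]

theorem isGAmenable_of_hasGAFixedPoint_l1 [LocallyCompactSpace G] [CompleteSpace A]
    (ν : Measure G) [ν.IsHaarMeasure]
    (hβ : ∀ (x : G) (a : A) (m : Elt M),
      (ι (β x a) : StrongDual ℂ (Elt M)) m = (ι a : StrongDual ℂ (Elt M)) (α x⁻¹ m))
    (h : HasGAFixedPoint ι (l1GAct ν β) (l1AAct (A := A) ν)) : IsGAmenable α := by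
  -- A normalized indicator: the interior of a compact neighbourhood of the identity has positive
  -- finite Haar measure.
  obtain ⟨ξ, hξ⟩ : ∃ ξ : Lp (Unit1 A) 1 ν, l1Integral (Unit1 A) ν ξ = 1 := by
    obtain ⟨K, hK, hKn⟩ := exists_compact_mem_nhds (1 : G)
    have hpos : 0 < ν (interior K) :=
      isOpen_interior.measure_pos ν ⟨1, mem_interior_iff_mem_nhds.2 hKn⟩
    have hfin : ν (interior K) ≠ ⊤ := ((measure_mono interior_subset).trans_lt hK.measure_lt_top).ne
    refine ⟨indicatorConstLp 1 isOpen_interior.measurableSet hfin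
      ((ν.real (interior K))⁻¹ • (1 : Unit1 A)), ?_⟩
    rw [l1Integral_apply, integral_indicatorConstLp, smul_smul, mul_inv_cancel₀, one_smul]
    exact (ENNReal.toReal_pos hpos.ne' hfin).ne'
  refine isGAmenable_of_hasGAFixedPoint h ξ
    (((ContinuousLinearMap.compL ℂ (Lp (Unit1 A) 1 ν) (Unit1 A) ℂ).flip
      (l1Integral (Unit1 A) ν)).comp (unit1Pairing ι)) ?_ ?_ ?_
  · intro a m
    change unit1Pairing ι m (l1Integral (Unit1 A) ν ((unit1Mul a).compLpL 1 ν ξ)) = _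
    rw [l1Integral_compLpL, hξ]
    simp [unit1Pairing_apply]
  · intro x a m
    change unit1Pairing ι m
      (l1Integral (Unit1 A) ν ((unit1Mul a).compLpL 1 ν (l1GAct ν β x ξ))) = _
    rw [l1Integral_compLpL, l1Integral_l1GAct, hξ]
    simp [unit1Pairing_apply]
  · intro x m
    ext f
    change unit1Pairing ι m (l1Integral (Unit1 A) ν (l1GAct ν β x f)) =
      unit1Pairing ι (α x⁻¹ m) (l1Integral (Unit1 A) ν f)
    rw [l1Integral_l1GAct, unit1Pairing_unit1Map hβ]

end L1Module

end GAmenable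

end

theorem theorem4p4
    {G : Type v} [Group G] [TopologicalSpace G] [IsTopologicalGroup G] [LocallyCompactSpace G]
    [T2Space G] [MeasurableSpace G] [BorelSpace G]
    (μ : Measure G) [μ.IsHaarMeasure] [μ.Regular]
    {H : Type u} [NormedAddCommGroup H] [InnerProductSpace ℂ H] [CompleteSpace H]
    (M : VonNeumannAlgebra H)
    -- an action of `G` on `M` by `*`-automorphisms, pointwise weak*-continuous
    (α : G →* (GAmenable.Elt M ≃⋆ₐ[ℂ] GAmenable.Elt M))
    (hα : ∀ (m : GAmenable.Elt M), ∀ φ ∈ GAmenable.predual M, Continuous fun x => φ (α x m))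
    -- the predual of `M` is a Banach algebra `A`
    {A : Type w} [NonUnitalNormedRing A] [NormedSpace ℂ A] [IsScalarTower ℂ A A]
    [SMulCommClass ℂ A A] [CompleteSpace A]
    (ι : A ≃ₗᵢ[ℂ] GAmenable.predual M)
    -- `β x` is the pre-adjoint of `α x⁻¹`
    (β : G → A →L[ℂ] A)
    (hβ : ∀ (x : G) (a : A) (m : GAmenable.Elt M),
      (ι (β x a) : StrongDual ℂ (GAmenable.Elt M)) m =
        (ι a : StrongDual ℂ (GAmenable.Elt M)) (α x⁻¹ m))
    -- each `β x` is an automorphism of the algebra `A`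
    (hβ_mul : ∀ (x : G) (a b : A), β x (a * b) = β x a * β x b) :
    List.TFAE [
      GAmenable.IsGAmenable α,
      GAmenable.HasGFixedPointProperty ι β,
      GAmenable.HasGAFixedPoint ι (fun x => GAmenable.unit1Map (β x))
        (fun a : A => GAmenable.unit1Mul a),
      GAmenable.HasGAFixedPoint ι (GAmenable.l1GAct μ β) (GAmenable.l1AAct (A := A) μ)] := by
  tfae_have 1 → 2 := fun h X _ _ _ Y =>
    GAmenable.hasGAFixedPoint_of_isGAmenable hβ h Y.gact Y.aact Y.covariant
  tfae_have 1 → 3 := fun h =>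
    GAmenable.hasGAFixedPoint_of_isGAmenable hβ h _ (GAmenable.unit1MulL A)
      (GAmenable.unit1Mul_covariant hβ hβ_mul)
  tfae_have 1 → 4 := fun h =>
    GAmenable.hasGAFixedPoint_of_isGAmenable hβ h _
      (ContinuousLinearMap.compLpL₂ 1 μ (GAmenable.unit1MulL A))
      (GAmenable.l1AAct_covariant μ hβ hβ_mul)
  tfae_have 2 → 1 := GAmenable.isGAmenable_of_hasGFixedPointProperty hα hβ hβ_mul
  tfae_have 3 → 1 := GAmenable.isGAmenable_of_hasGAFixedPoint_unit1 hβ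
  tfae_have 4 → 1 := GAmenable.isGAmenable_of_hasGAFixedPoint_l1 μ hβ
  tfae_finish
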